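/- Let $q\ge 1$ and let $c,d$ be relatively prime positive integers. Consider $q$ riders with the two basic moves $m_1=(1,0)$ and $m_2=(\pm c,\pm d)$ (one fixed choice of the two signs) on the square board $[0,1]^2$. For configurations $\mathbf z=(z_1,\dots,z_q)\in\mathbb R^{2q}$, $z_i=(x_i,y_i)\in\mathbb R^2$, the associated inside-out polytope consists of the cube $[0,1]^{2q}$, with facet hyperplanes $x_i=0$, $x_i=1$, $y_i=0$, $y_i=1$, together with the move hyperplanes $\{\mathbf z : (z_j-z_i)\cdot m^\perp=0\}$ for $i\ne j$ and $m\in\{m_1,m_2\}$, where $(a,b)^\perp=(b,-a)$. A vertex of the inside-out polytope is a point $\mathbf z$ of the cube such that $\{\mathbf z\}$ is the intersection of some set of facet hyperplanes and move hyperplanes; its denominator is the least positive integer $N$ such that $N\mathbf z\in\mathbb Z^{2q}$. The denominator $D$ of the inside-out polytope is the least common multiple of the denominators of all its vertices. Then $$D=\begin{cases}1 & \text{if } q=1,\\ d & \text{if } d\ge c \text{ and } q>1,\\ c & \text{if } d<c \text{ and } 1<q\le 2\lfloor c/d\rfloor+1,\\ cd & \text{if } d<c\text{ and } q\ge 2\lfloor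 c/d\rfloor+2.\end{cases}$$ -/

import Mathlib

namespace Riders

/-- A configuration of `q` pieces: a point `(z₁, …, z_q)` of `ℝ^{2q}`, where `z i = (xᵢ, yᵢ)` is the
position of the `i`-th piece. -/
abbrev Configuration (q : ℕ) : Type := Fin q → ℝ × ℝ

/-- The polytope `[0,1]^{2q}`: all pieces lie on the closed square board `[0,1]²`. -/
def polytope (q : ℕ) : Set (Configuration q) :=
  {z | ∀ i, (0 ≤ (z i).1 ∧ (z i).1 ≤ 1) ∧ (0 ≤ (z i).2 ∧ (z i).2 ≤ 1)}

/-- The facet hyperplanes of `[0,1]^{2q}` (the fixations): `xᵢ = 0`, `xᵢ = 1`, `yᵢ = 0`, `yᵢ = 1`. -/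
def facetHyperplanes (q : ℕ) : Set (Set (Configuration q)) :=
  {H | ∃ i : Fin q, H = {z | (z i).1 = 0} ∨ H = {z | (z i).1 = 1} ∨
    H = {z | (z i).2 = 0} ∨ H = {z | (z i).2 = 1}}

/-- The move hyperplane of the pieces `i`, `j` for the move `m = (c, d)`:
`(z_j - z_i) · m^⊥ = 0`, where `m^⊥ = (d, -c)`. -/
def moveHyperplane {q : ℕ} (m : ℤ × ℤ) (i j : Fin q) : Set (Configuration q) :=
  {z | ((z j).1 - (z i).1) * (m.2 : ℝ) + ((z j).2 - (z i).2) * (-(m.1 : ℝ)) = 0}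

/-- The move arrangement of `q` riders with set of basic moves `M`. -/
def moveArrangement (M : Set (ℤ × ℤ)) (q : ℕ) : Set (Set (Configuration q)) :=
  {H | ∃ m ∈ M, ∃ i j : Fin q, i ≠ j ∧ H = moveHyperplane m i j}

/-- The vertices of the inside-out polytope: the points of the polytope that are the
intersection of some facet hyperplanes and some move hyperplanes. -/
def vertices (M : Set (ℤ × ℤ)) (q : ℕ) : Set (Configuration q) :=
  {z | z ∈ polytope q ∧
    ∃ S : Set (Set (Configuration q)), S ⊆ facetHyperplanes q ∪ moveArrangement M q ∧ ⋂₀ S = {z}}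

/-- The denominator `Δ(z)` of a rational point `z`: the least positive integer `N` such that
all coordinates of `N z` are integers. (It is `0` if `z` is not rational.) -/
noncomputable def pointDenominator {q : ℕ} (z : Configuration q) : ℕ :=
  sInf {N : ℕ | 0 < N ∧
    ∀ i, (∃ a : ℤ, (N : ℝ) * (z i).1 = (a : ℝ)) ∧ (∃ b : ℤ, (N : ℝ) * (z i).2 = (b : ℝ))}

/-- The denominator of the inside-out polytope `([0,1]^{2q}, 𝒜)` for `q` riders with set of basic
moves `M`: the least common multiple of the denominators of its vertices, that is, the least
positive integer divisible by all of them. (It is `0` if there is none; so it is positive only if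
all vertices are rational and have a positive common multiple of denominators.) -/
noncomputable def denominator (M : Set (ℤ × ℤ)) (q : ℕ) : ℕ :=
  sInf {D : ℕ | 0 < D ∧ ∀ z ∈ vertices M q, pointDenominator z ∣ D}

end Riders

/-!
Reflecting the board in `x = 1/2` removes the signs, so let the second move be `(c, d)` with
`c, d > 0`. Write `u = d x - c y` for the offset of the line of slope `d / c` through a piece. The
move equations say `y i = y j` or `u i = u j`, the fixations of `y` say `y = 0` or `y = 1`, and a
fixation of `x` is the relation `u + c y = 0` or `u + c y = d` between a line and a row. A vertex
admits no motion of its rows and lines that keeps the equations it satisfies (`Rigid`).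

Since a fixation of `x` links `c y` and `-u` up to adding `d`, the rows and lines that are not
linked to `y = 0` or `y = 1` could be moved together. So `c y` lies in `d ℤ` or `c + d ℤ`, and `u`
in `d ℤ` or `-c + d ℤ` (`Rigid.lattice`). Hence `c d` clears all denominators, and if `c ≤ d` then
`y` is `0` or `1` and `d` suffices.

Let `d < c`. The abscissa `x = (u + c y) / d` is an integer unless the line of the piece is linked
to one horizontal edge and its row to the other. Linking a row or a line to its edge takes a zigzag
of pieces that alternate between the sides `x = 0` and `x = 1`: if one were missing, everything
beyond it could be moved (`Rigid.exists_left`, `Rigid.exists_right`). The zigzags from the two edges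
together with the piece itself have at least `2 ⌊c / d⌋ + 2` members (`Rigid.card_le`), so with
fewer pieces `c` clears all denominators.

Conversely, two pieces on the line through `(0, 0)` give the denominator `d` (if `c ≤ d`) or `c`
(if `d ≤ c`), and a full zigzag with a last piece at the top edge, at `x = c / d - ⌊c / d⌋`,
gives the factor `d` (`dvd_of_integralAt_zigzag`).
-/

/-! ### Vertices as unique solutions -/

namespace Riders

/-- The intercept of the line through `p` in the direction of the move `m`: two points are joined
by the move `m` exactly when their offsets agree. -/
noncomputable def offset (m : ℤ × ℤ) (p : ℝ × ℝ) : ℝ := (m.2 : ℝ) * p.1 - (m.1 : ℝ) * p.2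

@[simp] lemma offset_natCast (c d : ℕ) (p : ℝ × ℝ) :
    offset ((c : ℤ), (d : ℤ)) p = (d : ℝ) * p.1 - (c : ℝ) * p.2 := by
  simp [offset]

/-- `w` satisfies every fixation and every attacking equation (for the moves `(1, 0)` and `m`)
that `z` satisfies. -/
structure Preserves {q : ℕ} (m : ℤ × ℤ) (z w : Configuration q) : Prop where
  left : ∀ i, (z i).1 = 0 → (w i).1 = 0
  right : ∀ i, (z i).1 = 1 → (w i).1 = 1
  bottom : ∀ i, (z i).2 = 0 → (w i).2 = 0
  top : ∀ i, (z i).2 = 1 → (w i).2 = 1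
  row : ∀ i j, (z i).2 = (z j).2 → (w i).2 = (w j).2
  line : ∀ i j, offset m (z i) = offset m (z j) → offset m (w i) = offset m (w j)

/-- A point of the cube that is the only solution of all the equations it satisfies. By
`mem_vertices_iff` these are the vertices of the inside-out polytope for the moves `(1, 0)`, `m`. -/
def IsVertex {q : ℕ} (m : ℤ × ℤ) (z : Configuration q) : Prop :=
  z ∈ polytope q ∧ ∀ w, Preserves m z w → w = z

lemma mem_moveHyperplane_horizontal {q : ℕ} (i j : Fin q) (z : Configuration q) :
    z ∈ moveHyperplane ((1 : ℤ), (0 : ℤ)) i j ↔ (z i).2 = (z j).2 := by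
  simp only [moveHyperplane, Set.mem_ofPred_eq]
  push_cast
  constructor <;> intro h <;> linarith

lemma mem_moveHyperplane_iff {q : ℕ} (m : ℤ × ℤ) (i j : Fin q) (z : Configuration q) :
    z ∈ moveHyperplane m i j ↔ offset m (z i) = offset m (z j) := by
  simp only [moveHyperplane, offset, Set.mem_ofPred_eq]
  constructor <;> intro h <;> linarith

lemma mem_vertices_iff {q : ℕ} (m : ℤ × ℤ) (z : Configuration q) :
    z ∈ vertices {((1 : ℤ), (0 : ℤ)), m} q ↔ IsVertex m z := by
  refine and_congr_right fun _ => ⟨?_, fun h => ?_⟩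
  · rintro ⟨S, hS, hSz⟩ w hw
    have hz : z ∈ ⋂₀ S := hSz ▸ Set.mem_singleton z
    suffices w ∈ ⋂₀ S by rwa [hSz] at this
    intro H hH
    have hzH := hz H hH
    rcases hS hH with ⟨i, rfl | rfl | rfl | rfl⟩ | ⟨m', hm', i, j, -, rfl⟩
    · exact hw.left i hzH
    · exact hw.right i hzH
    · exact hw.bottom i hzH
    · exact hw.top i hzH
    · rcases hm' with rfl | hm'
      · rw [mem_moveHyperplane_horizontal] at hzH ⊢
        exact hw.row i j hzH
      · rw [Set.mem_singleton_iff] at hm'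
        subst hm'
        rw [mem_moveHyperplane_iff] at hzH ⊢
        exact hw.line i j hzH
  · refine ⟨{H | H ∈ facetHyperplanes q ∪ moveArrangement {((1 : ℤ), (0 : ℤ)), m} q ∧ z ∈ H},
      fun H hH => hH.1, Set.eq_singleton_iff_unique_mem.2 ⟨fun H hH => hH.2, fun w hw => h w ?_⟩⟩
    have key : ∀ H, H ∈ facetHyperplanes q ∪ moveArrangement {((1 : ℤ), (0 : ℤ)), m} q →
        z ∈ H → w ∈ H := fun H hH hz => hw H ⟨hH, hz⟩
    refine ⟨fun i => key _ (Or.inl ⟨i, Or.inl rfl⟩),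
      fun i => key _ (Or.inl ⟨i, Or.inr (Or.inl rfl)⟩),
      fun i => key _ (Or.inl ⟨i, Or.inr (Or.inr (Or.inl rfl))⟩),
      fun i => key _ (Or.inl ⟨i, Or.inr (Or.inr (Or.inr rfl))⟩), fun i j hij => ?_,
      fun i j hij => ?_⟩
    · rcases eq_or_ne i j with rfl | hne
      · rfl
      · rw [← mem_moveHyperplane_horizontal] at hij ⊢
        exact key _ (Or.inr ⟨_, Or.inl rfl, i, j, hne, rfl⟩) hij
    · rcases eq_or_ne i j with rfl | hne
      · rfl
      · rw [← mem_moveHyperplane_iff] at hij ⊢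
        exact key _ (Or.inr ⟨_, Or.inr rfl, i, j, hne, rfl⟩) hij

/-! ### Reflections of the board -/

/-- The mirror image of a configuration in the vertical line `x = 1/2`. -/
noncomputable def reflect {q : ℕ} (z : Configuration q) : Configuration q :=
  fun i => (1 - (z i).1, (z i).2)

@[simp] lemma reflect_reflect {q : ℕ} (z : Configuration q) : reflect (reflect z) = z := by
  funext i
  simp [reflect]

lemma IsVertex.neg {q : ℕ} {m : ℤ × ℤ} {z : Configuration q} (h : IsVertex m z) :
    IsVertex (-m) z := by
  refine ⟨h.1, fun w hw => h.2 w ⟨hw.left, hw.right, hw.bottom, hw.top, hw.row, fun i j hij => ?_⟩⟩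
  have hneg : ∀ p, offset (-m) p = -offset m p := fun p => by
    simp only [offset, Prod.fst_neg, Prod.snd_neg]
    push_cast
    ring
  have := hw.line i j (by rw [hneg, hneg, hij])
  rw [hneg, hneg] at this
  linarith

lemma IsVertex.reflect {q : ℕ} {a b : ℤ} {z : Configuration q} (h : IsVertex (a, b) z) :
    IsVertex (-a, b) (Riders.reflect z) := by
  have hoff : ∀ x y : ℝ, offset (-a, b) (x, y) = b - offset (a, b) (1 - x, y) := fun x y => by
    simp only [offset]
    push_cast
    ring
  refine ⟨fun i => ⟨⟨?_, ?_⟩, (h.1 i).2⟩, fun w hw => ?_⟩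
  · have := (h.1 i).1.2
    simp only [Riders.reflect]
    linarith
  · have := (h.1 i).1.1
    simp only [Riders.reflect]
    linarith
  rw [← h.2 (Riders.reflect w) ⟨fun i hi => ?_, fun i hi => ?_, fun i => hw.bottom i,
    fun i => hw.top i, fun i j => hw.row i j, fun i j hij => ?_⟩, reflect_reflect]
  · simp [Riders.reflect, hw.right i (by simp [Riders.reflect, hi])]
  · simp [Riders.reflect, hw.left i (by simp [Riders.reflect, hi])]
  · have := hw.line i j (by simpa [Riders.reflect, hoff] using hij)
    rw [← Prod.mk.eta (p := w i), ← Prod.mk.eta (p := w j), hoff, hoff] at this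
    exact sub_right_injective this

/-! ### Denominators -/

/-- All coordinates of `N • z` are integers. -/
def IntegralAt {q : ℕ} (N : ℕ) (z : Configuration q) : Prop :=
  ∀ i, (∃ a : ℤ, (N : ℝ) * (z i).1 = (a : ℝ)) ∧ (∃ b : ℤ, (N : ℝ) * (z i).2 = (b : ℝ))

lemma IntegralAt.mul_left {q N : ℕ} {z : Configuration q} (h : IntegralAt N z) (k : ℕ) :
    IntegralAt (k * N) z := by
  intro i
  obtain ⟨⟨a, ha⟩, b, hb⟩ := h i
  refine ⟨⟨k * a, ?_⟩, k * b, ?_⟩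
  · push_cast
    rw [← ha]
    ring
  · push_cast
    rw [← hb]
    ring

lemma IntegralAt.mod {q N P : ℕ} {z : Configuration q} (hN : IntegralAt N z)
    (hP : IntegralAt P z) : IntegralAt (N % P) z := by
  have hmod : ((N % P : ℕ) : ℝ) = N - P * (N / P : ℕ) := by
    rw [eq_sub_iff_add_eq]
    exact_mod_cast Nat.mod_add_div N P
  intro i
  obtain ⟨⟨a, ha⟩, b, hb⟩ := hN i
  obtain ⟨⟨a', ha'⟩, b', hb'⟩ := hP i
  refine ⟨⟨a - a' * ((N / P : ℕ) : ℤ), ?_⟩, b - b' * ((N / P : ℕ) : ℤ), ?_⟩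
  · rw [hmod]
    rw [Int.cast_sub, Int.cast_mul, Int.cast_natCast, ← ha, ← ha']
    ring
  · rw [hmod]
    rw [Int.cast_sub, Int.cast_mul, Int.cast_natCast, ← hb, ← hb']
    ring

lemma pointDenominator_dvd_iff {q N : ℕ} (hN : 0 < N) (z : Configuration q) :
    pointDenominator z ∣ N ↔ IntegralAt N z := by
  have hmem : ∀ {K : ℕ}, 0 < K → IntegralAt K z →
      0 < pointDenominator z ∧ IntegralAt (pointDenominator z) z :=
    fun {K} hK h => Nat.sInf_mem (s := {N : ℕ | 0 < N ∧ IntegralAt N z}) ⟨K, hK, h⟩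
  constructor
  · intro h
    have hpos : 0 < pointDenominator z := Nat.pos_of_dvd_of_pos h hN
    have hP := (Nat.sInf_mem (Nat.nonempty_of_pos_sInf hpos)).2
    obtain ⟨k, hk⟩ := h
    rw [hk, mul_comm]
    exact IntegralAt.mul_left hP k
  · intro h
    obtain ⟨hpos, hP⟩ := hmem hN h
    by_contra hdvd
    have hlt : N % pointDenominator z < pointDenominator z := Nat.mod_lt _ hpos
    exact Nat.notMem_of_lt_sInf hlt
      ⟨Nat.pos_of_ne_zero fun h0 => hdvd (Nat.dvd_of_mod_eq_zero h0), h.mod hP⟩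

lemma IntegralAt.reflect {q N : ℕ} {z : Configuration q} (h : IntegralAt N z) :
    IntegralAt N (Riders.reflect z) := by
  intro i
  obtain ⟨⟨a, ha⟩, hb⟩ := h i
  refine ⟨⟨N - a, ?_⟩, hb⟩
  simp only [Riders.reflect]
  push_cast
  rw [← ha]
  ring

/-- The signs of the second move do not matter: changing both leaves the arrangement as it is, and
changing one amounts to reflecting the board. -/
lemma integralAt_vertices_iff (c d : ℕ) (σ τ : ℤˣ) (q N : ℕ) :
    (∀ z : Configuration q, IsVertex ((σ : ℤ) * (c : ℤ), (τ : ℤ) * (d : ℤ)) z → IntegralAt N z) ↔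
      ∀ z : Configuration q, IsVertex ((c : ℤ), (d : ℤ)) z → IntegralAt N z := by
  rcases Int.units_eq_one_or σ with rfl | rfl <;> rcases Int.units_eq_one_or τ with rfl | rfl <;>
    simp only [Units.val_one, one_mul, Units.val_neg, neg_mul]
  · refine ⟨fun h z hz => ?_, fun h z hz => ?_⟩
    · have := (h _ (by simpa using hz.reflect.neg)).reflect
      rwa [reflect_reflect] at this
    · have := (h _ (by simpa using hz.reflect.neg)).reflect
      rwa [reflect_reflect] at this
  · refine ⟨fun h z hz => ?_, fun h z hz => ?_⟩
    · have := (h _ hz.reflect).reflect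
      rwa [reflect_reflect] at this
    · have := (h _ (by simpa using hz.reflect)).reflect
      rwa [reflect_reflect] at this
  · exact ⟨fun h z hz => h z (by simpa using hz.neg), fun h z hz => h z (by simpa using hz.neg)⟩

lemma denominator_eq {c d q N : ℕ} (σ τ : ℤˣ) (hN : 0 < N)
    (hint : ∀ z : Configuration q, IsVertex ((c : ℤ), (d : ℤ)) z → IntegralAt N z)
    (hdvd : ∀ D : ℕ, (∀ z : Configuration q, IsVertex ((c : ℤ), (d : ℤ)) z → IntegralAt D z) →
      N ∣ D) :
    denominator {((1 : ℤ), (0 : ℤ)), ((σ : ℤ) * (c : ℤ), (τ : ℤ) * (d : ℤ))} q = N := by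
  have hset : {D : ℕ | 0 < D ∧
      ∀ z ∈ vertices {((1 : ℤ), (0 : ℤ)), ((σ : ℤ) * (c : ℤ), (τ : ℤ) * (d : ℤ))} q,
        pointDenominator z ∣ D} =
      {D : ℕ | 0 < D ∧ ∀ z : Configuration q, IsVertex ((c : ℤ), (d : ℤ)) z → IntegralAt D z} := by
    ext D
    refine and_congr_right fun hD => ?_
    rw [← integralAt_vertices_iff c d σ τ]
    exact forall_congr' fun z => by rw [mem_vertices_iff, pointDenominator_dvd_iff hD]
  rw [denominator, hset]
  refine le_antisymm (Nat.sInf_le ⟨hN, hint⟩) (le_csInf ⟨N, hN, hint⟩ ?_)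
  rintro D ⟨hD, h⟩
  exact Nat.le_of_dvd hD (hdvd D h)

/-! ### Rigidity of vertices -/

/-- No nonzero displacement of the rows (`f`, a function of `y`) and of the lines along
`(c, d)` (`g`, a function of the offset) respects the fixations of `z`. The equation
`g + c f = 0` says that a piece on a vertical edge stays on it, since `d x = offset + c y`. -/
def Rigid {q : ℕ} (c d : ℕ) (z : Configuration q) : Prop :=
  ∀ f g : ℝ → ℝ, f 0 = 0 → f 1 = 0 →
    (∀ i, (z i).1 = 0 ∨ (z i).1 = 1 → g (d * (z i).1 - c * (z i).2) + c * f (z i).2 = 0) →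
    ∀ i, f (z i).2 = 0 ∧ g (d * (z i).1 - c * (z i).2) = 0

lemma IsVertex.rigid {c d q : ℕ} (hd : 0 < d) {z : Configuration q}
    (hz : IsVertex ((c : ℤ), (d : ℤ)) z) : Rigid c d z := by
  intro f g hf0 hf1 hfg i
  have hd' : (d : ℝ) ≠ 0 := by positivity
  set w : Configuration q := fun i => ((z i).1 + (g (d * (z i).1 - c * (z i).2) +
    c * f (z i).2) / d, (z i).2 + f (z i).2) with hw
  have hoff : ∀ i, offset ((c : ℤ), (d : ℤ)) (w i) =
      offset ((c : ℤ), (d : ℤ)) (z i) + g (offset ((c : ℤ), (d : ℤ)) (z i)) := fun i => by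
    simp only [offset_natCast, hw]
    field_simp
    ring
  have hwz : w = z := by
    refine hz.2 w ⟨fun i hi => ?_, fun i hi => ?_, fun i hi => ?_, fun i hi => ?_,
      fun i j hij => ?_, fun i j hij => ?_⟩
    · simp only [hw, hfg i (Or.inl hi), zero_div, add_zero]
      exact hi
    · simp only [hw, hfg i (Or.inr hi), zero_div, add_zero]
      exact hi
    · simp only [hw, hi, hf0, add_zero]
    · simp only [hw, hi, hf1, add_zero]
    · simp only [hw, hij]
    · rw [hoff, hoff, hij]
  constructor
  · have := congrArg Prod.snd (congrFun hwz i)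
    simpa [hw] using this
  · have := hoff i
    rw [hwz] at this
    simpa using this

/-- The half-turn of the board. -/
noncomputable def rotate {q : ℕ} (z : Configuration q) : Configuration q :=
  fun i => (1 - (z i).1, 1 - (z i).2)

lemma Rigid.rotate {c d q : ℕ} {z : Configuration q} (hz : Rigid c d z) :
    Rigid c d (Riders.rotate z) := by
  intro f g hf0 hf1 hfg i
  have hoff : ∀ i, (d : ℝ) * (1 - (z i).1) - c * (1 - (z i).2) =
      d - c - (d * (z i).1 - c * (z i).2) := fun i => by ring
  have := hz (fun y => f (1 - y)) (fun u => g (d - c - u)) (by simpa using hf1) (by simpa using hf0)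
    (fun i hi => by
      have h := hfg i (by
        simp only [Riders.rotate]
        rcases hi with hi | hi <;> simp [hi])
      simpa only [Riders.rotate, hoff] using h) i
  simpa only [Riders.rotate, hoff] using this

/-- The heights and the offsets of a rigid configuration lie in lattice cosets, because rows and
lines outside of these could be moved together. -/
lemma Rigid.lattice {c d q : ℕ} (hc : 0 < c) {z : Configuration q} (hz : Rigid c d z) (i : Fin q) :
    (∃ k : ℤ, c * (z i).2 = k * d ∨ c * (z i).2 = c + k * d) ∧
      ∃ k : ℤ, d * (z i).1 - c * (z i).2 = k * d ∨ d * (z i).1 - c * (z i).2 = k * d - c := by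
  classical
  have hc' : (c : ℝ) ≠ 0 := by positivity
  let A : ℝ → Prop := fun t => ∃ k : ℤ, t = k * d ∨ t = c + k * d
  have hA : ∀ t, A (t - d) ↔ A t := by
    refine fun t => ⟨fun ⟨k, hk⟩ => ⟨k + 1, ?_⟩, fun ⟨k, hk⟩ => ⟨k - 1, ?_⟩⟩
    · push_cast
      exact hk.imp (fun h => by linarith) fun h => by linarith
    · push_cast
      exact hk.imp (fun h => by linarith) fun h => by linarith
  obtain ⟨h1, h2⟩ := hz (fun y => if A (c * y) then 0 else 1) (fun u => if A (-u) then 0 else -c)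
    (if_pos ⟨0, by simp⟩) (if_pos ⟨0, by simp⟩) (fun i hi => by
      have hiff : A (-(d * (z i).1 - c * (z i).2)) ↔ A (c * (z i).2) := by
        rcases hi with hi | hi <;> rw [hi]
        · simp
        · rw [← hA (c * (z i).2)]
          ring_nf
      simp only [hiff]
      by_cases h : A (c * (z i).2) <;> simp [h]) i
  refine ⟨?_, ?_⟩
  · by_contra h
    simp [show ¬ A (c * (z i).2) from h] at h1
  · have h : A (-(d * (z i).1 - c * (z i).2)) := by
      by_contra h
      simp only [h, if_false] at h2
      exact hc' (by linarith)
    obtain ⟨k, hk⟩ := h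
    refine ⟨-k, ?_⟩
    push_cast
    exact hk.imp (fun h => by linarith) fun h => by linarith

/-! ### The zigzag forced by a non-integral abscissa -/

/-- `t` is one of the numbers `j d, (j + 1) d, …`. -/
def InTail (d j : ℕ) (t : ℝ) : Prop := ∃ l : ℕ, j ≤ l ∧ t = l * d

lemma InTail.mono {d j j' : ℕ} {t : ℝ} (h : InTail d j' t) (hj : j ≤ j') : InTail d j t :=
  let ⟨l, hl, ht⟩ := h
  ⟨l, hj.trans hl, ht⟩

lemma inTail_sub_iff {d j : ℕ} {t : ℝ} : InTail d j (t - d) ↔ InTail d (j + 1) t := by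
  constructor
  · rintro ⟨l, hl, ht⟩
    refine ⟨l + 1, by omega, ?_⟩
    push_cast
    linarith
  · rintro ⟨l, hl, ht⟩
    obtain ⟨l, rfl⟩ : ∃ l', l = l' + 1 := ⟨l - 1, by omega⟩
    refine ⟨l, by omega, ?_⟩
    push_cast at ht
    linarith

lemma InTail.eq_or_succ {d j : ℕ} {t : ℝ} (h : InTail d j t) :
    t = j * d ∨ InTail d (j + 1) t := by
  obtain ⟨l, hl, ht⟩ := h
  rcases hl.eq_or_lt with rfl | hl
  · exact Or.inl ht
  · exact Or.inr ⟨l, hl, ht⟩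

lemma not_inTail_zero {d j : ℕ} (hd : 0 < d) : ¬ InTail d (j + 1) 0 := by
  rintro ⟨l, hl, h⟩
  have : (0 : ℕ) = l * d := by exact_mod_cast h
  have := Nat.mul_pos (show 0 < l by omega) hd
  omega

lemma not_inTail_of_not_dvd {c d j : ℕ} (h : ¬ d ∣ c) : ¬ InTail d j c := by
  rintro ⟨l, -, hl⟩
  exact h ⟨l, by rw [mul_comm]; exact_mod_cast hl⟩

/-- If the zigzag from the origin had no piece at `(0, j d / c)`, the part of it beyond that point
could be moved. -/
lemma Rigid.exists_left {c d q : ℕ} (hc : 0 < c) (hd : 0 < d) (hcd : ¬ d ∣ c)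
    {z : Configuration q} (hz : Rigid c d z) {i : Fin q} {j : ℕ}
    (hi : InTail d (j + 1) (c * (z i).2) ∨ InTail d j (c * (z i).2 - d * (z i).1)) :
    ∃ i', (z i').1 = 0 ∧ c * (z i').2 = j * d := by
  classical
  have hc' : (c : ℝ) ≠ 0 := by positivity
  by_contra! hne
  obtain ⟨h1, h2⟩ := hz (fun y => if InTail d (j + 1) (c * y) then 1 else 0)
    (fun u => if InTail d j (-u) then -c else 0)
    (by simp [not_inTail_zero hd]) (by simp [not_inTail_of_not_dvd hcd]) (fun i hi => by
      have hiff : InTail d j (-(d * (z i).1 - c * (z i).2)) ↔ InTail d (j + 1) (c * (z i).2) := by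
        rcases hi with hi | hi
        · rw [hi, show -((d : ℝ) * 0 - c * (z i).2) = c * (z i).2 by ring]
          exact ⟨fun h => h.eq_or_succ.resolve_left (hne i hi), fun h => h.mono (by omega)⟩
        · rw [hi, ← inTail_sub_iff]
          ring_nf
      simp only [hiff]
      by_cases h : InTail d (j + 1) (c * (z i).2) <;> simp [h]) i
  rcases hi with hi | hi
  · simp [hi] at h1
  · simp [hi, hc'] at h2

/-- If the zigzag from the origin had no piece at `(1, (j + 1) d / c)`, the part of it beyond that
point could be moved. -/
lemma Rigid.exists_right {c d q : ℕ} (hc : 0 < c) (hd : 0 < d) (hcd : ¬ d ∣ c)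
    {z : Configuration q} (hz : Rigid c d z) {i : Fin q} {j : ℕ}
    (hi : InTail d (j + 1) (c * (z i).2) ∨ InTail d (j + 1) (c * (z i).2 - d * (z i).1)) :
    ∃ i', (z i').1 = 1 ∧ c * (z i').2 = (j + 1 : ℕ) * d := by
  classical
  have hc' : (c : ℝ) ≠ 0 := by positivity
  by_contra! hne
  obtain ⟨h1, h2⟩ := hz (fun y => if InTail d (j + 1) (c * y) then 1 else 0)
    (fun u => if InTail d (j + 1) (-u) then -c else 0)
    (by simp [not_inTail_zero hd]) (by simp [not_inTail_of_not_dvd hcd]) (fun i hi => by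
      have hiff : InTail d (j + 1) (-(d * (z i).1 - c * (z i).2)) ↔
          InTail d (j + 1) (c * (z i).2) := by
        rcases hi with hi | hi
        · rw [hi]
          ring_nf
        · rw [hi, show -((d : ℝ) * 1 - c * (z i).2) = c * (z i).2 - d by ring, inTail_sub_iff]
          exact ⟨fun h => h.mono (by omega), fun h => h.eq_or_succ.resolve_left (hne i hi)⟩
      simp only [hiff]
      by_cases h : InTail d (j + 1) (c * (z i).2) <;> simp [h]) i
  rcases hi with hi | hi
  · simp [hi] at h1
  · simp [hi, hc'] at h2

/-- A piece that lies on a line of the zigzag from the origin and in a row of the zigzag from the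
opposite corner `(1, 1)` needs all of the two zigzags up to there: with `k d` its offset and
`c + l d` the scaled height, where `k, l ≤ 0`, these are `2 |k| + 1` and `2 |l|` further pieces. As
`c` is not a multiple of `d`, the piece has `x < 1`, which forces `|k| + |l| ≥ ⌊c / d⌋`. -/
lemma Rigid.card_le {c d q : ℕ} (hc : 0 < c) (hd : 0 < d) (hcd : ¬ d ∣ c)
    {z : Configuration q} (hz : Rigid c d z) (hp : z ∈ polytope q) {i : Fin q} {k l : ℤ}
    (hk : d * (z i).1 - c * (z i).2 = k * d) (hl : c * (z i).2 = c + l * d) :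
    2 * (c / d) + 2 ≤ q := by
  have hd' : (0 : ℝ) < d := by exact_mod_cast hd
  have hc' : (0 : ℝ) < c := by exact_mod_cast hc
  have hndvd : ∀ n : ℤ, (c : ℝ) ≠ n * d := fun n hn => hcd (by
    rw [← Int.natCast_dvd_natCast]
    exact ⟨n, by rw [mul_comm]; exact_mod_cast hn⟩)
  have hx0 : (z i).1 ≠ 0 := fun h => hndvd (-(k + l)) (by
    push_cast
    rw [h] at hk
    linarith)
  have hx1 : (z i).1 ≠ 1 := fun h => hndvd (1 - (k + l)) (by
    push_cast
    rw [h] at hk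
    linarith)
  have hxlt : (z i).1 < 1 := lt_of_le_of_ne (hp i).1.2 hx1
  have hk0 : k ≤ 0 := by
    have h1 : (k : ℝ) * d < 1 * d := by nlinarith [mul_nonneg hc'.le (hp i).2.1]
    have : (k : ℝ) < 1 := lt_of_mul_lt_mul_right h1 hd'.le
    have : k < 1 := by exact_mod_cast this
    omega
  have hl0 : l ≤ 0 := by
    have h1 : (l : ℝ) * d ≤ 0 * d := by nlinarith [mul_le_mul_of_nonneg_left (hp i).2.2 hc'.le]
    have : (l : ℝ) ≤ 0 := le_of_mul_le_mul_right h1 hd'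
    exact_mod_cast this
  obtain ⟨k, rfl⟩ : ∃ k' : ℕ, k = -(k' : ℤ) := ⟨(-k).toNat, by omega⟩
  obtain ⟨l, rfl⟩ : ∃ l' : ℕ, l = -(l' : ℤ) := ⟨(-l).toNat, by omega⟩
  push_cast at hk hl
  have hkl : c / d ≤ k + l := by
    rw [← Nat.lt_succ_iff, Nat.div_lt_iff_lt_mul hd]
    have : (c : ℝ) < (k + l + 1 : ℕ) * d := by
      push_cast
      nlinarith
    exact_mod_cast this
  have hzr := hz.rotate
  have hA : ∀ j : Fin (k + 1), ∃ i', (z i').1 = 0 ∧ c * (z i').2 = (j : ℕ) * d := fun j =>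
    hz.exists_left hc hd hcd (i := i) (Or.inr ⟨k, by omega, by linarith⟩)
  have hB : ∀ j : Fin k, ∃ i', (z i').1 = 1 ∧ c * (z i').2 = ((j : ℕ) + 1 : ℕ) * d := fun j =>
    hz.exists_right hc hd hcd (i := i) (Or.inr ⟨k, by omega, by linarith⟩)
  have htail : ∀ j : Fin l, InTail d (j + 1) (c * (Riders.rotate z i).2) := fun j =>
    ⟨l, by omega, by simp only [Riders.rotate]; linarith⟩
  have hC : ∀ j : Fin l, ∃ i', (z i').1 = 1 ∧ c * (z i').2 = c - (j : ℕ) * d := fun j => by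
    obtain ⟨i', h1, h2⟩ := hzr.exists_left hc hd hcd (Or.inl (htail j))
    simp only [Riders.rotate] at h1 h2
    exact ⟨i', by linarith, by linarith⟩
  have hD : ∀ j : Fin l, ∃ i', (z i').1 = 0 ∧ c * (z i').2 = c - ((j : ℕ) + 1 : ℕ) * d :=
    fun j => by
      obtain ⟨i', h1, h2⟩ := hzr.exists_right hc hd hcd (Or.inl (htail j))
      simp only [Riders.rotate] at h1 h2
      exact ⟨i', by linarith, by linarith⟩
  choose a ha0 ha using hA
  choose b hb1 hb using hB
  choose e he1 he using hC
  choose t ht0 ht using hD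
  have hcancel : ∀ {m n : ℕ}, (m : ℝ) * d = n * d → m = n := fun h => by
    exact_mod_cast mul_right_cancel₀ hd'.ne' h
  -- The two zigzags share no row, as a common one would give `c = (m + n) d`.
  have hdisj : ∀ m n : ℕ, (m : ℝ) * d ≠ c - n * d := fun m n h => hndvd (m + n) (by
    push_cast
    linarith)
  have hainj : Function.Injective a := fun m n h => Fin.ext <| hcancel <| by
    rw [← ha m, ← ha n, h]
  have hbinj : Function.Injective b := fun m n h => Fin.ext <| Nat.succ_injective <| hcancel <| by
    rw [← hb m, ← hb n, h]
  have heinj : Function.Injective e := fun m n h => Fin.ext <| hcancel <| by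
    have h1 := he m
    rw [h, he n] at h1
    linarith
  have htinj : Function.Injective t := fun m n h => Fin.ext <| Nat.succ_injective <| hcancel <| by
    have h1 := ht m
    rw [h, ht n] at h1
    linarith
  have hleft : Function.Injective (Sum.elim a t) := hainj.sumElim htinj fun m n h =>
    hdisj m (n + 1) (by rw [← ha m, ← ht n, h])
  have hright : Function.Injective (Sum.elim b e) := hbinj.sumElim heinj fun m n h =>
    hdisj (m + 1) n (by rw [← hb m, ← he n, h])
  have hleft0 : ∀ m, (z (Sum.elim a t m)).1 = 0 := by
    rintro (m | m)
    · exact ha0 m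
    · exact ht0 m
  have hright1 : ∀ m, (z (Sum.elim b e m)).1 = 1 := by
    rintro (m | m)
    · exact hb1 m
    · exact he1 m
  have hinj : Function.Injective
      (Sum.elim (Sum.elim (Sum.elim a t) (Sum.elim b e)) (fun _ : Unit => i)) := by
    refine (hleft.sumElim hright fun m n h => ?_).sumElim
      (Function.injective_of_subsingleton _) ?_
    · have h1 := hleft0 m
      rw [h, hright1 n] at h1
      exact one_ne_zero h1
    · rintro (m | m) - h
      · exact hx0 (h ▸ hleft0 m)
      · exact hx1 (h ▸ hright1 m)
  have hcard := Fintype.card_le_of_injective _ hinj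
  simp only [Fintype.card_sum, Fintype.card_fin, Fintype.card_unit] at hcard
  omega

/-! ### Denominators of the vertices -/

lemma Rigid.integralAt_mul {c d q : ℕ} (hc : 0 < c) {z : Configuration q}
    (hz : Rigid c d z) : IntegralAt (c * d) z := by
  intro i
  have hy : ∃ b : ℤ, (c : ℝ) * (z i).2 = b := by
    obtain ⟨⟨k, hk | hk⟩, -⟩ := hz.lattice hc i
    · exact ⟨k * d, by push_cast; exact hk⟩
    · exact ⟨c + k * d, by push_cast; exact hk⟩
  have hu : ∃ u : ℤ, (d : ℝ) * (z i).1 - c * (z i).2 = u := by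
    obtain ⟨-, k, hk | hk⟩ := hz.lattice hc i
    · exact ⟨k * d, by push_cast; exact hk⟩
    · exact ⟨k * d - c, by push_cast; exact hk⟩
  obtain ⟨b, hb⟩ := hy
  obtain ⟨u, hu⟩ := hu
  refine ⟨⟨c * (u + b), ?_⟩, d * b, ?_⟩
  · push_cast
    rw [← hu, ← hb]
    ring
  · push_cast
    rw [← hb]
    ring

/-- If `c ≤ d` then the lattice meets the board only in its horizontal edges. -/
lemma Rigid.integralAt_of_le {c d q : ℕ} (hc : 0 < c) (hcd : c ≤ d) {z : Configuration q}
    (hz : Rigid c d z) (hp : z ∈ polytope q) : IntegralAt d z := by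
  intro i
  have hc' : (0 : ℝ) < c := by exact_mod_cast hc
  have hcd' : (c : ℝ) ≤ d := by exact_mod_cast hcd
  have hdpos : (0 : ℝ) < d := hc'.trans_le hcd'
  have hy0 := mul_nonneg hc'.le (hp i).2.1
  have hy1 := mul_le_mul_of_nonneg_left (hp i).2.2 hc'.le
  have hle : ∀ {k n : ℤ}, (k : ℝ) * d ≤ n * d → k ≤ n := fun h => by
    exact_mod_cast le_of_mul_le_mul_right h hdpos
  have hy : ∃ b : ℤ, (z i).2 = b := by
    obtain ⟨⟨k, hk | hk⟩, -⟩ := hz.lattice hc i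
    · have h0 : 0 ≤ k := hle (by push_cast; linarith)
      have h1 : k ≤ 1 := hle (by push_cast; linarith)
      obtain rfl | rfl : k = 0 ∨ k = 1 := by omega
      · exact ⟨0, mul_left_cancel₀ hc'.ne' (by push_cast at hk ⊢; linarith)⟩
      · refine ⟨1, mul_left_cancel₀ hc'.ne' (by push_cast at hk ⊢; linarith)⟩
    · have h0 : -1 ≤ k := hle (by push_cast; linarith)
      have h1 : k ≤ 0 := hle (by push_cast; linarith)
      obtain rfl | rfl : k = -1 ∨ k = 0 := by omega
      · exact ⟨0, mul_left_cancel₀ hc'.ne' (by push_cast at hk ⊢; linarith)⟩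
      · exact ⟨1, mul_left_cancel₀ hc'.ne' (by push_cast at hk ⊢; linarith)⟩
  obtain ⟨b, hb⟩ := hy
  refine ⟨?_, d * b, by push_cast; rw [hb]⟩
  obtain ⟨-, k, hk | hk⟩ := hz.lattice hc i
  · exact ⟨k * d + c * b, by push_cast; rw [← hb]; linarith⟩
  · exact ⟨k * d - c + c * b, by push_cast; rw [← hb]; linarith⟩

/-- With few pieces every abscissa is an integer. -/
lemma Rigid.integralAt_of_card_le {c d q : ℕ} (hc : 0 < c) (hd : 0 < d) (hcd : ¬ d ∣ c)
    (hq : q ≤ 2 * (c / d) + 1) {z : Configuration q} (hz : Rigid c d z) (hp : z ∈ polytope q) :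
    IntegralAt c z := by
  intro i
  have hd' : (d : ℝ) ≠ 0 := by positivity
  obtain ⟨⟨k, hk⟩, l, hl⟩ := hz.lattice hc i
  have hx : ∀ n : ℤ, (d : ℝ) * (z i).1 = n * d → ∃ a : ℤ, (c : ℝ) * (z i).1 = a := fun n hn =>
    ⟨c * n, by
      push_cast
      rw [mul_left_cancel₀ hd' (hn.trans (mul_comm _ _))]⟩
  rcases hk with hk | hk
  · refine ⟨?_, k * d, by push_cast; exact hk⟩
    rcases hl with hl | hl
    · exact hx (k + l) (by push_cast; linarith)
    · -- Here the piece lies on a line of the zigzag from `(1, 1)`, and a half-turn exchanges the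
      -- two corners.
      have hpr : Riders.rotate z ∈ polytope q := fun i => by
        obtain ⟨⟨h1, h2⟩, h3, h4⟩ := hp i
        simp only [Riders.rotate]
        exact ⟨⟨by linarith, by linarith⟩, by linarith, by linarith⟩
      have := hz.rotate.card_le hc hd hcd hpr (i := i) (k := 1 - l) (l := -k)
        (by simp only [Riders.rotate]; push_cast; linarith)
        (by simp only [Riders.rotate]; push_cast; linarith)
      omega
  · refine ⟨?_, c + k * d, by push_cast; exact hk⟩
    rcases hl with hl | hl
    · have := hz.card_le hc hd hcd hp hl hk
      omega
    · exact hx (k + l) (by push_cast; linarith)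

lemma IsVertex.integralAt_one {m : ℤ × ℤ} {z : Configuration 1} (hz : IsVertex m z) :
    IntegralAt 1 z := by
  classical
  -- The only piece may be moved freely along the open edges and in the open square.
  let r : ℝ → ℝ := fun t => if t = 0 ∨ t = 1 then t else t + 1
  have hr0 : r 0 = 0 := by simp [r]
  have hr1 : r 1 = 1 := by simp [r]
  have hw : (fun i => (r (z i).1, r (z i).2)) = z := by
    refine hz.2 _ ⟨fun i hi => ?_, fun i hi => ?_, fun i hi => ?_, fun i hi => ?_,
      fun i j _ => ?_, fun i j _ => ?_⟩
    · simp only [hi, hr0]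
    · simp only [hi, hr1]
    · simp only [hi, hr0]
    · simp only [hi, hr1]
    · rw [Subsingleton.elim i j]
    · rw [Subsingleton.elim i j]
  have hfix : ∀ t, r t = t → ∃ a : ℤ, ((1 : ℕ) : ℝ) * t = a := fun t ht => by
    by_cases h : t = 0 ∨ t = 1
    · rcases h with rfl | rfl
      · exact ⟨0, by simp⟩
      · exact ⟨1, by simp⟩
    · simp [r, h] at ht
  exact fun i => ⟨hfix _ (congrArg Prod.fst (congrFun hw i)),
    hfix _ (congrArg Prod.snd (congrFun hw i))⟩

/-! ### Vertices attaining the denominators -/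

lemma dvd_of_mul_div_eq_intCast {a b N : ℕ} (hb : 0 < b) (hab : Nat.Coprime b a) {n m : ℤ}
    (h : (N : ℝ) * ((a : ℝ) / b + m) = n) : b ∣ N := by
  have hb' : (b : ℝ) ≠ 0 := by positivity
  refine hab.dvd_of_dvd_mul_right ?_
  rw [← Int.natCast_dvd_natCast]
  refine ⟨n - N * m, ?_⟩
  have : (N : ℝ) * a = b * (n - N * m) := by
    rw [← h]
    field_simp
    ring
  exact_mod_cast this

/-- One piece in the corner `(0, 0)`, and all others on its line at the top edge. -/
lemma dvd_of_integralAt_top {c d q D : ℕ} (hd : 0 < d) (hcop : Nat.Coprime c d)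
    (hcd : c ≤ d) (hq : 1 < q)
    (h : ∀ z : Configuration q, IsVertex ((c : ℤ), (d : ℤ)) z → IntegralAt D z) : d ∣ D := by
  have hd' : (0 : ℝ) < d := by exact_mod_cast hd
  let i₀ : Fin q := ⟨0, by omega⟩
  let i₁ : Fin q := ⟨1, hq⟩
  let z : Configuration q := fun i => if i = i₀ then (0, 0) else ((c : ℝ) / d, 1)
  have hz0 : z i₀ = (0, 0) := if_pos rfl
  have hz1 : ∀ i, i ≠ i₀ → z i = ((c : ℝ) / d, 1) := fun i hi => if_neg hi
  have hv : IsVertex ((c : ℤ), (d : ℤ)) z := by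
    refine ⟨fun i => ?_, fun w hw => ?_⟩
    · by_cases hi : i = i₀
      · rw [hi, hz0]
        norm_num
      · rw [hz1 i hi]
        refine ⟨⟨by positivity, (div_le_one hd').2 (by exact_mod_cast hcd)⟩, by norm_num⟩
    · have hw0 : w i₀ = (0, 0) :=
        Prod.ext (hw.left i₀ (by rw [hz0])) (hw.bottom i₀ (by rw [hz0]))
      funext i
      by_cases hi : i = i₀
      · rw [hi, hw0, hz0]
      · have hy := hw.top i (by rw [hz1 i hi])
        have hu := hw.line i i₀ (by
          rw [hz1 i hi, hz0, offset_natCast, offset_natCast]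
          field_simp
          ring)
        rw [offset_natCast, offset_natCast, hw0, hy] at hu
        rw [hz1 i hi]
        refine Prod.ext ?_ hy
        rw [eq_div_iff hd'.ne']
        linarith
  obtain ⟨⟨n, hn⟩, -⟩ := h z hv i₁
  rw [hz1 i₁ (by simp [i₀, i₁])] at hn
  exact dvd_of_mul_div_eq_intCast (m := 0) hd hcop.symm (by simpa using hn)

/-- One piece in the corner `(0, 0)`, and all others on its line at the right edge. -/
lemma dvd_of_integralAt_right {c d q D : ℕ} (hc : 0 < c) (hcop : Nat.Coprime c d)
    (hdc : d ≤ c) (hq : 1 < q)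
    (h : ∀ z : Configuration q, IsVertex ((c : ℤ), (d : ℤ)) z → IntegralAt D z) : c ∣ D := by
  have hc' : (0 : ℝ) < c := by exact_mod_cast hc
  let i₀ : Fin q := ⟨0, by omega⟩
  let i₁ : Fin q := ⟨1, hq⟩
  let z : Configuration q := fun i => if i = i₀ then (0, 0) else (1, (d : ℝ) / c)
  have hz0 : z i₀ = (0, 0) := if_pos rfl
  have hz1 : ∀ i, i ≠ i₀ → z i = (1, (d : ℝ) / c) := fun i hi => if_neg hi
  have hv : IsVertex ((c : ℤ), (d : ℤ)) z := by
    refine ⟨fun i => ?_, fun w hw => ?_⟩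
    · by_cases hi : i = i₀
      · rw [hi, hz0]
        norm_num
      · rw [hz1 i hi]
        refine ⟨by norm_num, ⟨by positivity, (div_le_one hc').2 (by exact_mod_cast hdc)⟩⟩
    · have hw0 : w i₀ = (0, 0) :=
        Prod.ext (hw.left i₀ (by rw [hz0])) (hw.bottom i₀ (by rw [hz0]))
      funext i
      by_cases hi : i = i₀
      · rw [hi, hw0, hz0]
      · have hx := hw.right i (by rw [hz1 i hi])
        have hu := hw.line i i₀ (by
          rw [hz1 i hi, hz0, offset_natCast, offset_natCast]
          field_simp
          ring)
        rw [offset_natCast, offset_natCast, hw0, hx] at hu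
        rw [hz1 i hi]
        refine Prod.ext hx ?_
        rw [eq_div_iff hc'.ne']
        linarith
  obtain ⟨-, n, hn⟩ := h z hv i₁
  rw [hz1 i₁ (by simp [i₀, i₁])] at hn
  exact dvd_of_mul_div_eq_intCast (m := 0) hc hcop (by simpa using hn)

/-- The zigzag `(0, 0), (1, d/c), (0, d/c), (1, 2d/c), (0, 2d/c), …`, alternating between steps
along `(c, d)` and horizontal steps. -/
noncomputable def zigzag (c d i : ℕ) : ℝ × ℝ :=
  (((i % 2 : ℕ) : ℝ), (((i + 1) / 2 : ℕ) : ℝ) * d / c)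

lemma zigzag_two_mul (c d j : ℕ) : zigzag c d (2 * j) = (0, (j : ℝ) * d / c) := by
  simp [zigzag, show (2 * j + 1) / 2 = j by omega]

lemma zigzag_two_mul_add_one (c d j : ℕ) :
    zigzag c d (2 * j + 1) = (1, ((j : ℝ) + 1) * d / c) := by
  simp [zigzag, show (2 * j + 1 + 1) / 2 = j + 1 by omega, show (2 * j + 1) % 2 = 1 by omega]

/-- The fixations of `x` and the moves along the zigzag determine it from its start `(0, 0)`. -/
lemma Preserves.eq_zigzag {c d q n : ℕ} (hc : 0 < c) {z w : Configuration q}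
    (hw : Preserves ((c : ℤ), (d : ℤ)) z w)
    (hz : ∀ i : Fin q, (i : ℕ) ≤ n → z i = zigzag c d i) (k : ℕ) (hkq : k < q) (hkn : k ≤ n) :
    w ⟨k, hkq⟩ = zigzag c d k := by
  have hc' : (c : ℝ) ≠ 0 := by positivity
  induction k with
  | zero =>
    have h0 := hz ⟨0, hkq⟩ hkn
    exact Prod.ext (by rw [hw.left _ (by rw [h0]; simp [zigzag])]; simp [zigzag])
      (by rw [hw.bottom _ (by rw [h0]; simp [zigzag])]; simp [zigzag])
  | succ k ih =>
    have hwk := ih (by omega) (by omega)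
    have hzk := hz ⟨k, by omega⟩ (show k ≤ n by omega)
    have hzk' := hz ⟨k + 1, hkq⟩ hkn
    simp only at hzk hzk'
    obtain ⟨j, rfl | rfl⟩ : ∃ j, k = 2 * j ∨ k = 2 * j + 1 := ⟨k / 2, by omega⟩
    · rw [zigzag_two_mul] at hwk hzk
      rw [zigzag_two_mul_add_one] at hzk' ⊢
      have hx := hw.right _ (by rw [hzk'])
      have hu := hw.line ⟨2 * j + 1, hkq⟩ ⟨2 * j, by omega⟩ (by
        rw [hzk, hzk', offset_natCast, offset_natCast]
        field_simp
        ring)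
      rw [offset_natCast, offset_natCast, hwk, hx] at hu
      refine Prod.ext hx ?_
      refine mul_left_cancel₀ hc' ?_
      field_simp at hu ⊢
      linarith
    · have heq : zigzag c d (2 * j + 1 + 1) = (0, ((j + 1 : ℕ) : ℝ) * d / c) :=
        zigzag_two_mul c d (j + 1)
      rw [zigzag_two_mul_add_one] at hwk hzk
      rw [heq] at hzk' ⊢
      have hx := hw.left ⟨2 * j + 1 + 1, hkq⟩ (by rw [hzk'])
      have hy := hw.row ⟨2 * j + 1 + 1, hkq⟩ ⟨2 * j + 1, by omega⟩ (by
        rw [hzk, hzk']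
        push_cast
        rfl)
      rw [hwk] at hy
      refine Prod.ext hx (hy.trans ?_)
      push_cast
      rfl

/-- The zigzag from `(0, 0)` to `(0, n d / c)` with `n = ⌊c / d⌋`, and a piece on the line through
its last point at the top edge; the remaining pieces are in the corner `(0, 0)`. -/
lemma dvd_of_integralAt_zigzag {c d q D : ℕ} (hc : 0 < c) (hd : 0 < d) (hcop : Nat.Coprime c d)
    (hq : 2 * (c / d) + 2 ≤ q)
    (h : ∀ z : Configuration q, IsVertex ((c : ℤ), (d : ℤ)) z → IntegralAt D z) : d ∣ D := by
  have hc' : (0 : ℝ) < c := by exact_mod_cast hc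
  have hd' : (0 : ℝ) < d := by exact_mod_cast hd
  set n := c / d with hn
  have hnle : (n : ℝ) * d ≤ c := by exact_mod_cast Nat.div_mul_le_self c d
  have hnlt : (c : ℝ) < (n + 1) * d := by
    exact_mod_cast (Nat.div_lt_iff_lt_mul hd).1 (Nat.lt_succ_self n)
  let i₁ : Fin q := ⟨2 * n + 1, by omega⟩
  let i₂ : Fin q := ⟨2 * n, by omega⟩
  let z : Configuration q := fun i => if (i : ℕ) ≤ 2 * n then zigzag c d i else
    if (i : ℕ) = 2 * n + 1 then ((c : ℝ) / d - n, 1) else (0, 0)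
  have hzl : ∀ i : Fin q, (i : ℕ) ≤ 2 * n → z i = zigzag c d i := fun i hi => if_pos hi
  have hzt : z i₁ = ((c : ℝ) / d - n, 1) := by simp [z, i₁]
  have hzc : ∀ i : Fin q, 2 * n + 1 < (i : ℕ) → z i = (0, 0) := fun i hi => by
    simp [z, show ¬ (i : ℕ) ≤ 2 * n by omega, show (i : ℕ) ≠ 2 * n + 1 by omega]
  have hcases : ∀ i : Fin q, (i : ℕ) ≤ 2 * n ∨ i = i₁ ∨ 2 * n + 1 < (i : ℕ) := fun i => by
    rw [Fin.ext_iff]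
    simp only [i₁]
    omega
  have hv : IsVertex ((c : ℤ), (d : ℤ)) z := by
    refine ⟨fun i => ?_, fun w hw => ?_⟩
    · rcases hcases i with hi | rfl | hi
      · rw [hzl i hi]
        have h1 : (((i : ℕ) % 2 : ℕ) : ℝ) ≤ 1 := by
          exact_mod_cast Nat.lt_succ_iff.1 (Nat.mod_lt _ two_pos)
        have h2 : ((((i : ℕ) + 1) / 2 : ℕ) : ℝ) ≤ n := by
          exact_mod_cast show ((i : ℕ) + 1) / 2 ≤ n by omega
        refine ⟨⟨Nat.cast_nonneg _, h1⟩, by simp only [zigzag]; positivity, ?_⟩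
        exact (div_le_one hc').2 ((mul_le_mul_of_nonneg_right h2 hd'.le).trans hnle)
      · rw [hzt]
        refine ⟨⟨?_, ?_⟩, by norm_num⟩
        · exact sub_nonneg.2 ((le_div_iff₀ hd').2 hnle)
        · have := (div_lt_iff₀ hd').2 hnlt
          simp only
          linarith
      · rw [hzc i hi]
        norm_num
    · have hwl := hw.eq_zigzag hc hzl
      funext i
      rcases hcases i with hi | rfl | hi
      · rw [hzl i hi]
        exact hwl i i.2 hi
      · have hy := hw.top i₁ (by rw [hzt])
        have hw2 : w i₂ = (0, (n : ℝ) * d / c) := by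
          rw [← zigzag_two_mul]
          exact hwl (2 * n) i₂.2 le_rfl
        have hz2 : z i₂ = (0, (n : ℝ) * d / c) := by
          rw [← zigzag_two_mul]
          exact hzl i₂ le_rfl
        have hu := hw.line i₁ i₂ (by
          rw [hz2, hzt, offset_natCast, offset_natCast]
          field_simp
          ring)
        rw [offset_natCast, offset_natCast, hw2, hy] at hu
        rw [hzt]
        refine Prod.ext (mul_left_cancel₀ hd'.ne' ?_) hy
        field_simp at hu ⊢
        linarith
      · rw [hzc i hi]
        exact Prod.ext (hw.left i (by rw [hzc i hi])) (hw.bottom i (by rw [hzc i hi]))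
  obtain ⟨⟨a, ha⟩, -⟩ := h z hv i₁
  rw [hzt] at ha
  exact dvd_of_mul_div_eq_intCast (m := -n) hd hcop.symm (by
    push_cast
    rw [← sub_eq_add_neg]
    exact ha)

end Riders

theorem propositionP (c d : ℕ) (hc : 0 < c) (hd : 0 < d) (hcd : Nat.Coprime c d)
    (σ τ : ℤˣ) (q : ℕ) :
    (q = 1 →
      Riders.denominator {((1 : ℤ), (0 : ℤ)), ((σ : ℤ) * (c : ℤ), (τ : ℤ) * (d : ℤ))} q = 1) ∧
    (c ≤ d → 1 < q →
      Riders.denominator {((1 : ℤ), (0 : ℤ)), ((σ : ℤ) * (c : ℤ), (τ : ℤ) * (d : ℤ))} q = d) ∧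
    (d < c → 1 < q → q ≤ 2 * ⌊(c : ℚ) / (d : ℚ)⌋₊ + 1 →
      Riders.denominator {((1 : ℤ), (0 : ℤ)), ((σ : ℤ) * (c : ℤ), (τ : ℤ) * (d : ℤ))} q = c) ∧
    (d < c → 2 * ⌊(c : ℚ) / (d : ℚ)⌋₊ + 2 ≤ q →
      Riders.denominator {((1 : ℤ), (0 : ℤ)), ((σ : ℤ) * (c : ℤ), (τ : ℤ) * (d : ℤ))} q = c * d) := by
  have hfloor : ⌊(c : ℚ) / (d : ℚ)⌋₊ = c / d := Nat.floor_div_eq_div c d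
  rw [hfloor]
  refine ⟨?_, fun hle hq => ?_, fun hlt hq hq' => ?_, fun hlt hq => ?_⟩
  · rintro rfl
    exact Riders.denominator_eq σ τ one_pos (fun z hz => hz.integralAt_one) fun D _ => one_dvd D
  · exact Riders.denominator_eq σ τ hd
      (fun z hz => (hz.rigid hd).integralAt_of_le hc hle hz.1)
      fun D => Riders.dvd_of_integralAt_top hd hcd hle hq
  · refine Riders.denominator_eq σ τ hc (fun z hz => ?_)
      fun D => Riders.dvd_of_integralAt_right hc hcd hlt.le hq
    by_cases hdvd : d ∣ c
    · have h := (hz.rigid hd).integralAt_mul hc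
      rwa [Nat.eq_one_of_dvd_coprimes hcd hdvd dvd_rfl, mul_one] at h
    · exact (hz.rigid hd).integralAt_of_card_le hc hd hdvd hq' hz.1
  · exact Riders.denominator_eq σ τ (Nat.mul_pos hc hd)
      (fun z hz => (hz.rigid hd).integralAt_mul hc)
      fun D h => hcd.mul_dvd_of_dvd_of_dvd
        (Riders.dvd_of_integralAt_right hc hcd hlt.le (by omega) h)
        (Riders.dvd_of_integralAt_zigzag hc hd hcd hq h)
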